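/- Let $a, b > 0$, and let $X_1, X_2, \ldots$ be i.i.d. random variables with the symmetric variance-gamma (generalized Laplace) distribution with location $m = 0$, shape $a$ and scale $b$, that is, with the law of $\sqrt{bG}\,Z$, where $G \sim \Gamma(a,1)$ (density $x^{a-1}e^{-x}/\Gamma(a)$, $x>0$) and $Z \sim \mathcal N(0,1)$ are independent. Put $$\hat V' = \frac1N\sum_{j=1}^N X_j^2, \qquad \hat K' = \frac1N\sum_{j=1}^N X_j^4, \qquad \hat a = \frac{3(\hat V')^2}{\hat K' - 3(\hat V')^2}, \qquad \hat b = \frac{\hat K'}{3\hat V'} - \hat V'.$$ Then, as $N \to \infty$, $\sqrt N\,[(\hat a,\hat b) - (a,b)]$ converges in distribution to the bivariate normal distribution $\mathcal N_2([0,0],\Sigma)$ with $$\Sigma = \frac13\begin{bmatrix} 2(4a^4+36a^3+95a^2+63a) & -2(4a^3+36a^2+101a+69)\,b \\ -2(4a^3+36a^2+101a+69)\,b & (8a^2+72a+220+159a^{-1})\,b^2 \end{bmatrix}$$ (in particular, this matrix is positive semidefinite). -/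

import Mathlib

open MeasureTheory ProbabilityTheory Filter

/-- The symmetric variance-gamma (generalized Laplace) distribution with location `m`, shape `a`
and scale `b`: the law of `m + √(b G) Z`, where `G` has the gamma distribution with shape `a` and
rate `1`, `Z` is standard normal, and `G` and `Z` are independent. -/
noncomputable def symmetricVarianceGamma (m a b : ℝ) : Measure ℝ :=
  ((gammaMeasure a 1).prod (gaussianReal 0 1)).map (fun p => m + √(b * p.1) * p.2)

/-- The raw (uncentered) empirical moment of order `k` of the first `N` observations. -/
noncomputable def empiricalRawMoment {Ω : Type*} (X : ℕ → Ω → ℝ) (k N : ℕ) (ω : Ω) : ℝ :=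
  (1 / (N : ℝ)) * ∑ i ∈ Finset.range N, X i ω ^ k

/-- The moment estimator of the shape parameter `a`: `3 V² / (K - 3 V²)`, with `V` and `K` the
raw empirical moments of orders two and four. -/
noncomputable def shapeEstimator {Ω : Type*} (X : ℕ → Ω → ℝ) (N : ℕ) (ω : Ω) : ℝ :=
  3 * empiricalRawMoment X 2 N ω ^ 2 /
    (empiricalRawMoment X 4 N ω - 3 * empiricalRawMoment X 2 N ω ^ 2)

/-- The moment estimator of the scale parameter `b`: `K / (3 V) - V`, with `V` and `K` the
raw empirical moments of orders two and four. -/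
noncomputable def scaleEstimator {Ω : Type*} (X : ℕ → Ω → ℝ) (N : ℕ) (ω : Ω) : ℝ :=
  empiricalRawMoment X 4 N ω / (3 * empiricalRawMoment X 2 N ω) - empiricalRawMoment X 2 N ω

/-- The limiting covariance matrix of the two estimators. -/
noncomputable def limitCovariance (a b : ℝ) : Matrix (Fin 2) (Fin 2) ℝ :=
  (1 / 3 : ℝ) •
    !![2 * (4 * a ^ 4 + 36 * a ^ 3 + 95 * a ^ 2 + 63 * a),
        -2 * (4 * a ^ 3 + 36 * a ^ 2 + 101 * a + 69) * b;
      -2 * (4 * a ^ 3 + 36 * a ^ 2 + 101 * a + 69) * b,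
        (8 * a ^ 2 + 72 * a + 220 + 159 / a) * b ^ 2]

/-! The estimators are `g = shapeScaleOfMoments` evaluated at the empirical mean of `(X², X⁴)`, and
`g θ = (a, b)` at the true moments `θ = (ab, 3b²a(a+1))`. By the multivariate central limit theorem
the mean, centred at `θ` and scaled by `√N`, tends to `N(0, S)`. Here `S` is the covariance of `(X²,
X⁴)`, computed from the moments of orders 2, 4, 6, 8, which factor as `E[(bG)^k] E[Z^(2k)]`. The
delta method turns the limit into `N(0, J S Jᵀ)` with `J` the Jacobian of `g` at `θ`, and
`shapeScaleJacobian_mul_momentCovariance` identifies `J S Jᵀ` with `Σ`. Semidefiniteness comes for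
free, as `S` is a covariance matrix.

The multivariate theorem reduces to the real one by projecting on each direction (Cramér–Wold). The
delta method is an exact factorisation `g y - g θ = L(y)(y - θ)` with `L` continuous at `θ`,
combined with the strong law and Slutsky's theorem. -/

open scoped Topology RealInnerProductSpace Matrix

/-! ### Moments of the normal, gamma and variance-gamma laws. -/

section Moments

open scoped Nat

lemma integral_even_pow_gaussianReal (k : ℕ) :
    ∫ x, x ^ (2 * k) ∂(gaussianReal 0 1) = ((2 * k - 1)‼ : ℕ) := by
  rw [integral_gaussianReal_eq_integral_smul one_ne_zero]
  simp only [gaussianPDFReal, NNReal.coe_one, mul_one, sub_zero, smul_eq_mul]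
  -- Evenness folds the integral onto the half-line, where it is a Gamma integral.
  have h1 : (fun x : ℝ => (√(2 * Real.pi))⁻¹ * Real.exp (-x ^ 2 / 2) * x ^ (2 * k)) =
      fun x : ℝ => (fun y : ℝ => (√(2 * Real.pi))⁻¹ *
        (y ^ (2 * k) * Real.exp (-y ^ 2 / 2))) |x| := by
    ext x
    simp only [sq_abs, pow_mul]
    ring
  rw [h1, integral_comp_abs (f := fun y : ℝ => (√(2 * Real.pi))⁻¹ *
        (y ^ (2 * k) * Real.exp (-y ^ 2 / 2))), integral_const_mul]
  have h2 := integral_rpow_mul_exp_neg_mul_rpow (p := 2) (q := (2 * k : ℕ)) (b := 1 / 2)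
    two_pos (by linarith [(Nat.cast_nonneg (2 * k) : (0 : ℝ) ≤ _)]) (by norm_num)
  have h3 : ∫ y in Set.Ioi (0 : ℝ), y ^ (2 * k) * Real.exp (-y ^ 2 / 2) =
      ∫ y in Set.Ioi (0 : ℝ), y ^ ((2 * k : ℕ) : ℝ) * Real.exp (-(1 / 2) * y ^ (2 : ℝ)) := by
    refine setIntegral_congr_fun measurableSet_Ioi fun y _ => ?_
    simp only [Real.rpow_natCast, Real.rpow_ofNat]
    ring_nf
  rw [h3, h2]
  have h4 : ((2 * k : ℕ) + 1 : ℝ) / 2 = k + 1 / 2 := by push_cast; ring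
  have h5 : (1 / 2 : ℝ) ^ (-((2 * k : ℕ) + 1 : ℝ) / 2) = 2 ^ k * √2 := by
    rw [neg_div, h4, one_div, Real.inv_rpow two_pos.le, Real.rpow_neg two_pos.le, inv_inv,
      Real.rpow_add two_pos, Real.rpow_natCast, Real.sqrt_eq_rpow]
    norm_num
  rw [h5, h4, Real.Gamma_nat_add_half, Real.sqrt_mul two_pos.le]
  have : √Real.pi ≠ 0 := by positivity
  field_simp

lemma integrable_pow_gaussianReal (n : ℕ) : Integrable (fun x : ℝ => x ^ n) (gaussianReal 0 1) := by
  refine ((memLp_id_gaussianReal (μ := 0) (v := 1) (n : NNReal)).integrable_norm_pow').mono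
    (by fun_prop) (ae_of_all _ fun x => by simp)

/-- Dropping the null point `0` leaves only `x > 0`, where real powers add and Euler's integral
lives. -/
lemma gammaMeasure_eq_withDensity_restrict (a r : ℝ) :
    gammaMeasure a r = (volume.restrict (Set.Ioi 0)).withDensity
      fun x => ENNReal.ofReal (gammaPDFReal a r x) := by
  rw [Measure.restrict_congr_set Ioi_ae_eq_Ici, ← withDensity_indicator measurableSet_Ici, gammaMeasure]
  congr 1
  ext x
  by_cases hx : 0 ≤ x
  · simp [hx, gammaPDF]
  · simp [hx, gammaPDF_of_neg (not_le.1 hx)]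

lemma integrable_pow_gammaMeasure {a : ℝ} (ha : 0 < a) (k : ℕ) :
    Integrable (fun x : ℝ => x ^ k) (gammaMeasure a 1) ∧
      ∫ x, x ^ k ∂(gammaMeasure a 1) = Real.Gamma (a + k) / Real.Gamma a := by
  have hpos : 0 < a + k := by positivity
  have hG := Real.Gamma_pos_of_pos ha
  have heq : Set.EqOn (fun x => (ENNReal.ofReal (gammaPDFReal a 1 x)).toReal • x ^ k)
      (fun x => (Real.Gamma a)⁻¹ * (Real.exp (-x) * x ^ (a + k - 1))) (Set.Ioi 0) := by
    intro x hx
    have hx : 0 < x := hx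
    simp only [ENNReal.toReal_ofReal (gammaPDFReal_nonneg ha one_pos x)]
    simp only [gammaPDFReal, hx.le, if_true, smul_eq_mul, Real.one_rpow, one_mul]
    rw [show a + k - 1 = (a - 1) + k by ring, Real.rpow_add hx, Real.rpow_natCast]
    ring
  rw [gammaMeasure_eq_withDensity_restrict]
  constructor
  · rw [integrable_withDensity_iff_integrable_smul' (by fun_prop) (by simp)]
    exact IntegrableOn.congr_fun ((Real.GammaIntegral_convergent hpos).const_mul _) heq.symm
      measurableSet_Ioi
  · rw [integral_withDensity_eq_integral_toReal_smul (by fun_prop) (by simp),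
      setIntegral_congr_fun measurableSet_Ioi heq, integral_const_mul,
      ← Real.Gamma_eq_integral hpos]
    field_simp

/-- Needed for `√(bG)² = bG`, which fails for negative arguments. -/
lemma ae_nonneg_gammaMeasure (a r : ℝ) : ∀ᵐ x ∂(gammaMeasure a r), 0 ≤ x := by
  rw [gammaMeasure_eq_withDensity_restrict]
  refine (withDensity_absolutelyContinuous _ _).ae_le ?_
  filter_upwards [ae_restrict_mem measurableSet_Ioi] with x hx using le_of_lt hx

/-- The even moments of the symmetric variance-gamma distribution. -/
lemma integrable_even_pow_symmetricVarianceGamma {a b : ℝ} (ha : 0 < a) (hb : 0 < b) (k : ℕ) :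
    Integrable (fun x : ℝ => x ^ (2 * k)) (symmetricVarianceGamma 0 a b) ∧
      ∫ x, x ^ (2 * k) ∂(symmetricVarianceGamma 0 a b) =
        b ^ k * (Real.Gamma (a + k) / Real.Gamma a) * ((2 * k - 1)‼ : ℕ) := by
  have := isProbabilityMeasure_gammaMeasure ha one_pos
  have hm : Measurable fun p : ℝ × ℝ => 0 + √(b * p.1) * p.2 := by fun_prop
  have hae : (fun p : ℝ × ℝ => b ^ k * p.1 ^ k * p.2 ^ (2 * k))
      =ᵐ[(gammaMeasure a 1).prod (gaussianReal 0 1)]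
      fun p => (0 + √(b * p.1) * p.2) ^ (2 * k) := by
    have h1 := Measure.quasiMeasurePreserving_fst
      (μ := gammaMeasure a 1) (ν := gaussianReal 0 1) |>.ae (ae_nonneg_gammaMeasure a 1)
    filter_upwards [h1] with p hp
    rw [zero_add, mul_pow √(b * p.1), pow_mul √(b * p.1), Real.sq_sqrt (by positivity), mul_pow b]
  obtain ⟨hi, hv⟩ := integrable_pow_gammaMeasure ha k
  rw [symmetricVarianceGamma]
  constructor
  · rw [integrable_map_measure (by fun_prop) hm.aemeasurable]
    exact ((hi.const_mul (b ^ k)).mul_prod (integrable_pow_gaussianReal (2 * k))).congr hae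
  · rw [integral_map hm.aemeasurable (by fun_prop), ← integral_congr_ae hae,
      integral_prod_mul (fun x : ℝ => b ^ k * x ^ k) (fun y : ℝ => y ^ (2 * k)),
      integral_const_mul, hv, integral_even_pow_gaussianReal]

lemma integral_pow_two_symmetricVarianceGamma {a b : ℝ} (ha : 0 < a) (hb : 0 < b) :
    ∫ x, x ^ 2 ∂(symmetricVarianceGamma 0 a b) = a * b := by
  rw [(integrable_even_pow_symmetricVarianceGamma ha hb 1).2]
  have := (Real.Gamma_pos_of_pos ha).ne'
  rw [Nat.cast_one, Real.Gamma_add_one ha.ne']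
  simp
  field_simp

lemma Gamma_add_two_div {a : ℝ} (ha : 0 < a) :
    Real.Gamma (a + 2) / Real.Gamma a = a * (a + 1) := by
  rw [show a + 2 = a + 1 + 1 by ring, Real.Gamma_add_one (by positivity),
    Real.Gamma_add_one ha.ne']
  have := (Real.Gamma_pos_of_pos ha).ne'
  field_simp

lemma integral_pow_four_symmetricVarianceGamma {a b : ℝ} (ha : 0 < a) (hb : 0 < b) :
    ∫ x, x ^ 4 ∂(symmetricVarianceGamma 0 a b) = 3 * b ^ 2 * (a * (a + 1)) := by
  have h := (integrable_even_pow_symmetricVarianceGamma ha hb 2).2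
  rw [Nat.cast_ofNat, Gamma_add_two_div ha] at h
  rw [h]
  norm_num [Nat.doubleFactorial]
  ring

lemma integral_pow_six_symmetricVarianceGamma {a b : ℝ} (ha : 0 < a) (hb : 0 < b) :
    ∫ x, x ^ 6 ∂(symmetricVarianceGamma 0 a b) =
      15 * b ^ 3 * (a * (a + 1) * (a + 2)) := by
  have h := (integrable_even_pow_symmetricVarianceGamma ha hb 3).2
  rw [Nat.cast_ofNat, show a + 3 = a + 2 + 1 by ring, Real.Gamma_add_one (by positivity),
    mul_div_assoc, Gamma_add_two_div ha] at h
  rw [h]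
  norm_num [Nat.doubleFactorial]
  ring

lemma integral_pow_eight_symmetricVarianceGamma {a b : ℝ} (ha : 0 < a) (hb : 0 < b) :
    ∫ x, x ^ 8 ∂(symmetricVarianceGamma 0 a b) =
      105 * b ^ 4 * (a * (a + 1) * (a + 2) * (a + 3)) := by
  have h := (integrable_even_pow_symmetricVarianceGamma ha hb 4).2
  rw [Nat.cast_ofNat, show a + 4 = a + 2 + 1 + 1 by ring, Real.Gamma_add_one (by positivity),
    Real.Gamma_add_one (by positivity), mul_div_assoc, mul_div_assoc, Gamma_add_two_div ha] at h
  rw [h]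
  norm_num [Nat.doubleFactorial]
  ring

end Moments

/-! ### Multivariate central limit theorem, delta method, linear images of Gaussians. -/

section GeneralLimitTheorems

variable {Ω ι : Type*} [MeasurableSpace Ω] {P : Measure Ω} [IsProbabilityMeasure P]

lemma variance_inner_eq_dotProduct_covariance [Fintype ι] {Y : Ω → EuclideanSpace ℝ ι}
    (hY : MemLp Y 2 P) (t : EuclideanSpace ℝ ι) :
    Var[fun ω => ⟪Y ω, t⟫; P] =
      t ⬝ᵥ (Matrix.of fun i j => cov[fun ω => Y ω i, fun ω => Y ω j; P]) *ᵥ t := by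
  have hYi (i : ι) : MemLp (fun ω => Y ω i) 2 P :=
    (EuclideanSpace.proj (𝕜 := ℝ) i).comp_memLp' hY
  have hin : (fun ω => ⟪Y ω, t⟫) = fun ω => ∑ i, t i * Y ω i := by
    ext ω; simp [PiLp.inner_apply]
  have hmem (i : ι) : MemLp (fun ω => t i * Y ω i) 2 P := (hYi i).const_mul _
  rw [hin, ← covariance_self (Finset.aemeasurable_fun_sum _ fun i _ => (hmem i).aemeasurable),
    covariance_fun_sum_fun_sum hmem hmem]
  simp only [covariance_const_mul_left, covariance_const_mul_right, dotProduct, Matrix.mulVec,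
    Matrix.of_apply, Finset.mul_sum]
  refine Finset.sum_congr rfl fun i _ => Finset.sum_congr rfl fun j _ => by ring

lemma posSemidef_covariance [Fintype ι] {Y : Ω → EuclideanSpace ℝ ι} (hY : MemLp Y 2 P) :
    (Matrix.of fun i j => cov[fun ω => Y ω i, fun ω => Y ω j; P]).PosSemidef := by
  refine Matrix.PosSemidef.of_dotProduct_mulVec_nonneg ?_ fun x => ?_
  · ext i j
    simp [covariance_comm]
  · have := variance_inner_eq_dotProduct_covariance hY (WithLp.toLp 2 x)
    simp only [star_trivial]
    rw [← this]
    exact variance_nonneg _ _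

omit [IsProbabilityMeasure P] in
lemma aemeasurable_inv_sqrt_smul_sum_sub [Fintype ι] {Y : ℕ → Ω → EuclideanSpace ℝ ι}
    (hY : ∀ k, AEMeasurable (Y k) P) (n : ℕ) (c : EuclideanSpace ℝ ι) :
    AEMeasurable (fun ω => (√(n : ℝ))⁻¹ • (∑ k ∈ Finset.range n, Y k ω - c)) P :=
  ((measurable_id.sub_const c).const_smul (√(n : ℝ))⁻¹).comp_aemeasurable
    (Finset.aemeasurable_fun_sum _ fun k _ => hY k)

lemma tendsto_charFun_inv_sqrt_smul_sum_sub [Fintype ι] [DecidableEq ι]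
    {Y : ℕ → Ω → EuclideanSpace ℝ ι} (hY : MemLp (Y 0) 2 P) (hindep : iIndepFun Y P)
    (hident : ∀ i, IdentDistrib (Y i) (Y 0) P P) (t : EuclideanSpace ℝ ι) :
    Tendsto (fun n : ℕ => charFun (P.map fun ω =>
        (√(n : ℝ))⁻¹ • (∑ k ∈ Finset.range n, Y k ω - (n : ℝ) • P[Y 0])) t)
      atTop (𝓝 (charFun (multivariateGaussian 0
        (Matrix.of fun i j => cov[fun ω => Y 0 ω i, fun ω => Y 0 ω j; P])) t)) := by
  have hYm (k : ℕ) : AEMeasurable (Y k) P := (hident k).aemeasurable_fst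
  have hmeas : Measurable fun y : EuclideanSpace ℝ ι => ⟪y, t⟫ := by fun_prop
  have hint : Integrable (Y 0) P := hY.integrable (by norm_num)
  have hclt := tendstoInDistribution_inv_sqrt_mul_sum_sub
    (X := fun k ω => ⟪Y k ω, t⟫) (P := P) (Y := id)
    (P' := gaussianReal 0 Var[fun ω => ⟪Y 0 ω, t⟫; P].toNNReal) ⟨aemeasurable_id, by simp⟩
    (hY.inner_const t)
    (hindep.comp (fun _ y => ⟪y, t⟫) fun _ => hmeas) fun k => (hident k).comp hmeas
  -- The characteristic function of `⟪Y, t⟫` at `1` is that of `Y` at `t`.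
  have h1 := ProbabilityMeasure.tendsto_iff_tendsto_charFun.1 hclt.tendsto 1
  simp only [ProbabilityMeasure.coe_mk, Measure.map_id, charFun_gaussianReal] at h1
  rw [charFun_multivariateGaussian (posSemidef_covariance hY),
    ← variance_inner_eq_dotProduct_covariance hY]
  have hmean : P[fun ω => ⟪Y 0 ω, t⟫] = ⟪P[Y 0], t⟫ := by
    simp_rw [real_inner_comm t]
    exact integral_inner hint t
  convert h1 using 2
  · rename_i n
    rw [charFun_apply, charFun_apply,
      integral_map (aemeasurable_inv_sqrt_smul_sum_sub hYm n _) (by fun_prop),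
      integral_map (hclt.forall_aemeasurable n) (by fun_prop)]
    congr 1 with ω
    simp [inner_smul_left, inner_sub_left, sum_inner, hmean]
  · simp [variance_nonneg]

/-- The multivariate central limit theorem. -/
theorem tendstoInDistribution_inv_sqrt_smul_sum_sub [Fintype ι] [DecidableEq ι]
    {Y : ℕ → Ω → EuclideanSpace ℝ ι} (hY : MemLp (Y 0) 2 P) (hindep : iIndepFun Y P)
    (hident : ∀ i, IdentDistrib (Y i) (Y 0) P P) :
    TendstoInDistribution
      (fun (n : ℕ) ω => (√(n : ℝ))⁻¹ • (∑ k ∈ Finset.range n, Y k ω - (n : ℝ) • P[Y 0]))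
      atTop (id : EuclideanSpace ℝ ι → EuclideanSpace ℝ ι) (fun _ => P)
      (multivariateGaussian 0
        (Matrix.of fun i j => cov[fun ω => Y 0 ω i, fun ω => Y 0 ω j; P])) where
  forall_aemeasurable n :=
    aemeasurable_inv_sqrt_smul_sum_sub (fun k => (hident k).aemeasurable_fst) n _
  tendsto := by
    refine ProbabilityMeasure.tendsto_iff_tendsto_charFun.2 fun t => ?_
    simp only [ProbabilityMeasure.coe_mk, Measure.map_id]
    exact tendsto_charFun_inv_sqrt_smul_sum_sub hY hindep hident t

/-- The difference quotient operator of a differentiable map, normalised so that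
`g y - g x = slopeOperator g A x y (y - x)` and so that it is continuous at `x`. -/
noncomputable def slopeOperator {E F : Type*} [NormedAddCommGroup E] [InnerProductSpace ℝ E]
    [NormedAddCommGroup F] [NormedSpace ℝ F] (g : E → F) (A : E →L[ℝ] F) (x y : E) : E →L[ℝ] F :=
  A + (innerSL ℝ (y - x)).smulRight ((‖y - x‖ ^ 2)⁻¹ • (g y - g x - A (y - x)))

section SlopeOperator

variable {E F : Type*} [NormedAddCommGroup E] [InnerProductSpace ℝ E]
    [NormedAddCommGroup F] [NormedSpace ℝ F] {g : E → F} {A : E →L[ℝ] F} {x : E}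

lemma slopeOperator_apply_sub (g : E → F) (A : E →L[ℝ] F) (x y : E) :
    slopeOperator g A x y (y - x) = g y - g x := by
  rcases eq_or_ne y x with rfl | h
  · simp
  · have : ‖y - x‖ ^ 2 ≠ 0 := by simpa [sub_eq_zero] using h
    rw [slopeOperator, add_apply, ContinuousLinearMap.smulRight_apply, innerSL_apply_apply,
      real_inner_self_eq_norm_sq, smul_smul, mul_inv_cancel₀ this, one_smul, add_sub_cancel]

/-- The rank-one correction has norm `‖g y - g x - A (y - x)‖ / ‖y - x‖`, exactly the quotient in
Fréchet differentiability. -/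
lemma tendsto_slopeOperator (hg : HasFDerivAt g A x) :
    Tendsto (slopeOperator g A x) (𝓝 x) (𝓝 A) := by
  rw [tendsto_iff_norm_sub_tendsto_zero]
  have h0 := (hasFDerivAt_iff_tendsto.1 hg)
  convert h0 using 2 with y
  simp only [slopeOperator, add_sub_cancel_left, ContinuousLinearMap.norm_smulRight_apply,
    innerSL_apply_norm, norm_smul, norm_inv, norm_pow, norm_norm]
  rcases eq_or_ne ‖y - x‖ 0 with h | h
  · simp [h]
  · field_simp

lemma measurable_slopeOperator [FiniteDimensional ℝ E] [MeasurableSpace E] [BorelSpace E]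
    [SecondCountableTopology F] [MeasurableSpace F] [BorelSpace F] (hg : Measurable g) :
    Measurable (slopeOperator g A x) := by
  have : ProperSpace E := FiniteDimensional.proper_real E
  have : Continuous fun p : E × F => (innerSL ℝ p.1).smulRight p.2 := by fun_prop
  refine Measurable.const_add (this.measurable.comp (Measurable.prodMk ?_ ?_)) A
  · fun_prop
  · exact Measurable.smul (by fun_prop) ((hg.sub_const _).sub (by fun_prop))

end SlopeOperator

/-- The delta method. -/
theorem TendstoInDistribution.delta_method {E F Ω' : Type*} [MeasurableSpace Ω']
    {P' : Measure Ω'} [IsProbabilityMeasure P']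
    [NormedAddCommGroup E] [InnerProductSpace ℝ E] [FiniteDimensional ℝ E]
    [MeasurableSpace E] [BorelSpace E]
    [NormedAddCommGroup F] [NormedSpace ℝ F] [SecondCountableTopology F]
    [MeasurableSpace F] [BorelSpace F]
    {T : ℕ → Ω → E} {Z : Ω' → E} {r : ℕ → ℝ} {θ : E} {g : E → F} {A : E →L[ℝ] F}
    (hT : ∀ n, AEMeasurable (T n) P) (hlim : ∀ᵐ ω ∂P, Tendsto (fun n => T n ω) atTop (𝓝 θ))
    (h : TendstoInDistribution (fun n ω => r n • (T n ω - θ)) atTop Z (fun _ => P) P')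
    (hgm : Measurable g) (hg : HasFDerivAt g A θ) :
    TendstoInDistribution (fun n ω => r n • (g (T n ω) - g θ)) atTop (fun ω => A (Z ω))
      (fun _ => P) P' := by
  have : ProperSpace E := FiniteDimensional.proper_real E
  have hmeas (n : ℕ) : AEMeasurable (fun ω => slopeOperator g A θ (T n ω)) P :=
    (measurable_slopeOperator hgm).comp_aemeasurable (hT n)
  have hmes : TendstoInMeasure P (fun n ω => slopeOperator g A θ (T n ω)) atTop fun _ => A := by
    refine tendstoInMeasure_of_tendsto_ae (fun n => (hmeas n).aestronglyMeasurable) ?_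
    filter_upwards [hlim] with ω hω using (tendsto_slopeOperator hg).comp hω
  have hcont : Continuous fun p : E × (E →L[ℝ] F) => p.2 p.1 := by fun_prop
  -- Slutsky's theorem for the evaluation map `(v, L) ↦ L v`.
  convert h.continuous_comp_prodMk_of_tendstoInMeasure_const hcont hmes hmeas using 3 with n ω
  rw [map_smul, slopeOperator_apply_sub]

lemma map_toEuclideanCLM_multivariateGaussian [Fintype ι] [DecidableEq ι] {S : Matrix ι ι ℝ}
    (hS : S.PosSemidef) (J : Matrix ι ι ℝ) :
    (multivariateGaussian 0 S).map (Matrix.toEuclideanCLM (𝕜 := ℝ) J) =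
      multivariateGaussian 0 (J * S * Jᵀ) := by
  have hS' : (J * S * Jᵀ).PosSemidef := by
    simpa using hS.mul_mul_conjTranspose_same J
  refine Measure.ext_of_charFun (funext fun t => ?_)
  rw [charFun_multivariateGaussian hS', charFun_apply,
    integral_map (by fun_prop) (by fun_prop)]
  have hin (x : EuclideanSpace ℝ ι) : ⟪Matrix.toEuclideanCLM (𝕜 := ℝ) J x, t⟫ =
      ⟪x, Matrix.toEuclideanCLM (𝕜 := ℝ) Jᵀ t⟫ := by
    have : Jᵀ = star J := by simp [Matrix.star_eq_conjTranspose]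
    rw [this, map_star, ContinuousLinearMap.star_eq_adjoint,
      ContinuousLinearMap.adjoint_inner_right]
  simp_rw [hin]
  rw [← charFun_apply, charFun_multivariateGaussian hS]
  simp only [inner_zero_right, Matrix.ofLp_toEuclideanCLM, ← Matrix.mulVec_mulVec]
  congr 4
  rw [Matrix.dotProduct_mulVec t J, ← Matrix.mulVec_transpose]

end GeneralLimitTheorems

/-! ### The moment map, its Jacobian and the covariance of `(X², X⁴)`. -/

section MomentEstimators

/-- The map sending the second and fourth raw moments to the shape and scale parameters. -/
noncomputable def shapeScaleOfMoments (y : EuclideanSpace ℝ (Fin 2)) : EuclideanSpace ℝ (Fin 2) :=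
  !₂[3 * y 0 ^ 2 / (y 1 - 3 * y 0 ^ 2), y 1 / (3 * y 0) - y 0]

/-- The Jacobian matrix of `shapeScaleOfMoments` at the moments of the symmetric variance-gamma
distribution. -/
noncomputable def shapeScaleJacobian (a b : ℝ) : Matrix (Fin 2) (Fin 2) ℝ :=
  !![2 * (a + 1) / b, -1 / (3 * b ^ 2); -(2 * a + 1) / a, 1 / (3 * a * b)]

/-- The covariance matrix of `(X², X⁴)` for `X` symmetric variance-gamma. -/
noncomputable def momentCovariance (a b : ℝ) : Matrix (Fin 2) (Fin 2) ℝ :=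
  !![b ^ 2 * (2 * a ^ 2 + 3 * a), 6 * a * b ^ 3 * (a + 1) * (2 * a + 5);
    6 * a * b ^ 3 * (a + 1) * (2 * a + 5),
      3 * b ^ 4 * a * (a + 1) * (32 * a ^ 2 + 172 * a + 210)]

/-- The second and fourth moments of the symmetric variance-gamma distribution. -/
noncomputable def momentVector (a b : ℝ) : EuclideanSpace ℝ (Fin 2) :=
  !₂[a * b, 3 * b ^ 2 * (a * (a + 1))]

variable {a b : ℝ}

/-- Global measurability is needed because the empirical moments may fall where a denominator
vanishes; division by zero is `0` there. -/
lemma measurable_shapeScaleOfMoments : Measurable shapeScaleOfMoments := by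
  refine (PiLp.continuous_toLp 2 _).measurable.comp (measurable_pi_lambda _ fun i => ?_)
  fin_cases i
  · simp only [Fin.zero_eta, Matrix.cons_val_zero]
    fun_prop
  · simp only [Fin.mk_one, Matrix.cons_val_one]
    fun_prop

lemma shapeScaleOfMoments_momentVector (ha : 0 < a) (hb : 0 < b) :
    shapeScaleOfMoments (momentVector a b) = !₂[a, b] := by
  have h : 3 * b ^ 2 * (a * (a + 1)) - 3 * (a * b) ^ 2 = 3 * b ^ 2 * a := by ring
  ext i
  fin_cases i
  · simp only [shapeScaleOfMoments, momentVector, Fin.zero_eta, PiLp.toLp_apply,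
      Matrix.cons_val_zero, Matrix.cons_val_one, h]
    field_simp
  · simp only [shapeScaleOfMoments, momentVector, Fin.mk_one, PiLp.toLp_apply,
      Matrix.cons_val_zero, Matrix.cons_val_one]
    field_simp
    ring

lemma hasFDerivAt_div_of_ne_zero {E : Type*} [NormedAddCommGroup E] [NormedSpace ℝ E]
    {f g : E → ℝ} {f' g' : E →L[ℝ] ℝ} {x : E} (hf : HasFDerivAt f f' x) (hg : HasFDerivAt g g' x)
    (hx : g x ≠ 0) :
    HasFDerivAt (fun y => f y / g y) ((g x)⁻¹ • f' - (f x / g x ^ 2) • g') x := by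
  simp_rw [div_eq_mul_inv]
  refine (hf.mul ((hasDerivAt_inv hx).comp_hasFDerivAt x hg)).congr_fderiv ?_
  ext v
  simp
  ring

lemma hasFDerivAt_shapeScaleOfMoments (ha : 0 < a) (hb : 0 < b) :
    HasFDerivAt shapeScaleOfMoments
      (Matrix.toEuclideanCLM (𝕜 := ℝ) (shapeScaleJacobian a b)) (momentVector a b) := by
  -- The denominator of the shape estimator at the true moments; its positivity makes the moment map
  -- differentiable there.
  have h : 3 * b ^ 2 * (a * (a + 1)) - 3 * (a * b) ^ 2 = 3 * b ^ 2 * a := by ring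
  have h0 := (EuclideanSpace.proj (0 : Fin 2) : EuclideanSpace ℝ (Fin 2) →L[ℝ] ℝ).hasFDerivAt
    (x := momentVector a b)
  have h1 := (EuclideanSpace.proj (1 : Fin 2) : EuclideanSpace ℝ (Fin 2) →L[ℝ] ℝ).hasFDerivAt
    (x := momentVector a b)
  refine hasFDerivWithinAt_univ.1 (hasFDerivWithinAt_euclidean.2 fun i =>
    HasFDerivAt.hasFDerivWithinAt ?_)
  fin_cases i
  · have hn := (h0.pow 2).const_mul 3
    have hd := h1.sub hn
    have hne : momentVector a b 1 - 3 * momentVector a b 0 ^ 2 ≠ 0 := by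
      simp only [momentVector, PiLp.toLp_apply, Matrix.cons_val_zero, Matrix.cons_val_one, h]
      positivity
    refine (hasFDerivAt_div_of_ne_zero hn hd hne).congr_fderiv ?_
    ext v
    simp [Matrix.ofLp_toEuclideanCLM, shapeScaleJacobian, momentVector, Matrix.mulVec, dotProduct,
      h]
    field_simp
    ring
  · have hd := h0.const_mul 3
    have hne : 3 * momentVector a b 0 ≠ 0 := by
      simp only [momentVector, PiLp.toLp_apply, Matrix.cons_val_zero]
      positivity
    refine ((hasFDerivAt_div_of_ne_zero h1 hd hne).sub h0).congr_fderiv ?_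
    ext v
    simp [Matrix.ofLp_toEuclideanCLM, shapeScaleJacobian, momentVector, Matrix.mulVec, dotProduct]
    field_simp
    ring

lemma shapeScaleJacobian_mul_momentCovariance (ha : 0 < a) (hb : 0 < b) :
    shapeScaleJacobian a b * momentCovariance a b * (shapeScaleJacobian a b)ᵀ =
      limitCovariance a b := by
  ext i j
  fin_cases i <;> fin_cases j <;>
  · simp [shapeScaleJacobian, momentCovariance, limitCovariance, Matrix.mul_apply,
      Fin.sum_univ_two]
    field_simp
    ring

variable {Ω : Type*} [MeasurableSpace Ω] {P : Measure Ω}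

/-- The random vector `(x², x⁴)`. -/
noncomputable def squareFourth (x : ℝ) : EuclideanSpace ℝ (Fin 2) := !₂[x ^ 2, x ^ 4]

lemma continuous_squareFourth : Continuous squareFourth := by
  refine (PiLp.continuous_toLp 2 _).comp (continuous_pi fun i => ?_)
  fin_cases i
  · simp only [Fin.zero_eta, Matrix.cons_val_zero]
    fun_prop
  · simp only [Fin.mk_one, Matrix.cons_val_one]
    fun_prop

lemma memLp_squareFourth (ha : 0 < a) (hb : 0 < b) {X : Ω → ℝ}
    (hX : HasLaw X (symmetricVarianceGamma 0 a b) P) :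
    MemLp (fun ω => squareFourth (X ω)) 2 P := by
  have key (k : ℕ) : MemLp (fun ω => X ω ^ (2 * k)) 2 P := by
    have hm := hX.aemeasurable
    refine (memLp_two_iff_integrable_sq (by fun_prop)).2 ?_
    -- Square integrability of `X^(2k)` is integrability of `X^(4k)`.
    have := (integrable_even_pow_symmetricVarianceGamma ha hb (2 * k)).1
    rw [← hX.map_eq, integrable_map_measure (by fun_prop) hm] at this
    refine this.congr (ae_of_all _ fun ω => ?_)
    simp only [Function.comp_apply]
    ring
  refine MemLp.of_eval_piLp fun i => ?_
  fin_cases i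
  · exact key 1
  · exact key 2

lemma integral_pow_comp {X : Ω → ℝ} (hX : HasLaw X (symmetricVarianceGamma 0 a b) P) (n : ℕ) :
    ∫ ω, X ω ^ n ∂P = ∫ x, x ^ n ∂(symmetricVarianceGamma 0 a b) := by
  rw [← hX.map_eq, integral_map hX.aemeasurable (by fun_prop)]

lemma integral_squareFourth [IsProbabilityMeasure P] (ha : 0 < a) (hb : 0 < b) {X : Ω → ℝ}
    (hX : HasLaw X (symmetricVarianceGamma 0 a b) P) :
    ∫ ω, squareFourth (X ω) ∂P = momentVector a b := by
  have hint := (memLp_squareFourth ha hb hX).integrable one_le_two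
  have h (i : Fin 2) : (∫ ω, squareFourth (X ω) ∂P) i = ∫ ω, squareFourth (X ω) i ∂P :=
    ((EuclideanSpace.proj (𝕜 := ℝ) i).integral_comp_comm hint).symm
  ext i
  rw [h]
  fin_cases i
  · exact (integral_pow_comp hX 2).trans (integral_pow_two_symmetricVarianceGamma ha hb)
  · exact (integral_pow_comp hX 4).trans (integral_pow_four_symmetricVarianceGamma ha hb)

lemma covariance_squareFourth [IsProbabilityMeasure P] (ha : 0 < a) (hb : 0 < b) {X : Ω → ℝ}
    (hX : HasLaw X (symmetricVarianceGamma 0 a b) P) :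
    (Matrix.of fun i j => cov[fun ω => squareFourth (X ω) i, fun ω => squareFourth (X ω) j; P]) =
      momentCovariance a b := by
  have hL (i : Fin 2) : MemLp (fun ω => squareFourth (X ω) i) 2 P :=
    (EuclideanSpace.proj (𝕜 := ℝ) i).comp_memLp' (memLp_squareFourth ha hb hX)
  have h0 : (fun ω => squareFourth (X ω) 0) = fun ω => X ω ^ 2 := rfl
  have h1 : (fun ω => squareFourth (X ω) 1) = fun ω => X ω ^ 4 := rfl
  have e2 := (integral_pow_comp hX 2).trans (integral_pow_two_symmetricVarianceGamma ha hb)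
  have e4 := (integral_pow_comp hX 4).trans (integral_pow_four_symmetricVarianceGamma ha hb)
  have e6 := (integral_pow_comp hX 6).trans (integral_pow_six_symmetricVarianceGamma ha hb)
  have e8 := (integral_pow_comp hX 8).trans (integral_pow_eight_symmetricVarianceGamma ha hb)
  ext i j
  rw [Matrix.of_apply, covariance_eq_sub (hL i) (hL j)]
  fin_cases i <;> fin_cases j <;>
  · simp only [Fin.zero_eta, Fin.mk_one, h0, h1, Pi.mul_def, ← pow_add, Nat.reduceAdd, e2, e4, e6,
      e8, momentCovariance, Matrix.of_apply, Matrix.cons_val_zero, Matrix.cons_val_one,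
      Matrix.cons_val', Matrix.cons_val_fin_one]
    ring

omit [MeasurableSpace Ω] in
lemma inv_smul_sum_squareFourth (X : ℕ → Ω → ℝ) (N : ℕ) (ω : Ω) :
    (N : ℝ)⁻¹ • ∑ k ∈ Finset.range N, squareFourth (X k ω) =
      !₂[empiricalRawMoment X 2 N ω, empiricalRawMoment X 4 N ω] := by
  ext i
  fin_cases i <;> simp [squareFourth, empiricalRawMoment]

omit [MeasurableSpace Ω] in
lemma shapeScaleOfMoments_inv_smul_sum (X : ℕ → Ω → ℝ) (N : ℕ) (ω : Ω) :
    shapeScaleOfMoments ((N : ℝ)⁻¹ • ∑ k ∈ Finset.range N, squareFourth (X k ω)) =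
      !₂[shapeEstimator X N ω, scaleEstimator X N ω] := by
  rw [inv_smul_sum_squareFourth]
  rfl

/-- Passes from the normalisation of sums to that of means; at `N = 0` both sides are `0`. -/
lemma inv_sqrt_smul_sub_eq {E : Type*} [AddCommGroup E] [Module ℝ E] (N : ℕ) (s c : E) :
    (√(N : ℝ))⁻¹ • (s - (N : ℝ) • c) = √(N : ℝ) • ((N : ℝ)⁻¹ • s - c) := by
  rcases N.eq_zero_or_pos with rfl | hN
  · simp
  · have hN' : (0 : ℝ) < N := by exact_mod_cast hN
    have h1 : √(N : ℝ) * (N : ℝ)⁻¹ = (√(N : ℝ))⁻¹ := by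
      rw [← div_eq_mul_inv, Real.sqrt_div_self]
    have h2 : (√(N : ℝ))⁻¹ * N = √(N : ℝ) := by
      rw [mul_comm, ← div_eq_mul_inv, Real.div_sqrt]
    rw [smul_sub, smul_sub, smul_smul, smul_smul, h1, h2]

end MomentEstimators

theorem theorem3 {Ω : Type*} [MeasurableSpace Ω] (P : Measure Ω) [IsProbabilityMeasure P]
    (a b : ℝ) (ha : 0 < a) (hb : 0 < b) (X : ℕ → Ω → ℝ)
    (hindep : iIndepFun X P)
    (hlaw : ∀ i, HasLaw (X i) (symmetricVarianceGamma 0 a b) P) :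
    (limitCovariance a b).PosSemidef ∧
    TendstoInDistribution
      (fun (N : ℕ) (ω : Ω) =>
        √(N : ℝ) • (!₂[shapeEstimator X N ω, scaleEstimator X N ω] - !₂[a, b] :
          EuclideanSpace ℝ (Fin 2)))
      atTop (id : EuclideanSpace ℝ (Fin 2) → EuclideanSpace ℝ (Fin 2))
      (fun _ => P) (multivariateGaussian 0 (limitCovariance a b)) := by
  have hmem := memLp_squareFourth ha hb (hlaw 0)
  have hmean := integral_squareFourth ha hb (hlaw 0)
  have hcov := covariance_squareFourth ha hb (hlaw 0)
  have hS : (momentCovariance a b).PosSemidef := hcov ▸ posSemidef_covariance hmem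
  have hident (i : ℕ) : IdentDistrib (fun ω => squareFourth (X i ω))
      (fun ω => squareFourth (X 0 ω)) P P :=
    IdentDistrib.comp (f := X i) (g := X 0) (u := squareFourth) ⟨(hlaw i).aemeasurable,
      (hlaw 0).aemeasurable, (hlaw i).map_eq.trans (hlaw 0).map_eq.symm⟩
      continuous_squareFourth.measurable
  have hind : iIndepFun (fun i ω => squareFourth (X i ω)) P :=
    hindep.comp (fun _ => squareFourth) fun _ => continuous_squareFourth.measurable
  have hclt := tendstoInDistribution_inv_sqrt_smul_sum_sub hmem hind hident
  rw [hcov, hmean] at hclt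
  simp_rw [inv_sqrt_smul_sub_eq] at hclt
  have hlln := strong_law_ae (fun i ω => squareFourth (X i ω)) (hmem.integrable one_le_two)
    (fun i j hij => hind.indepFun hij) hident
  rw [hmean] at hlln
  have hmeas (n : ℕ) : AEMeasurable
      (fun ω => (n : ℝ)⁻¹ • ∑ k ∈ Finset.range n, squareFourth (X k ω)) P :=
    (Finset.aemeasurable_fun_sum _ fun k _ => (hident k).aemeasurable_fst).fun_const_smul _
  have hdelta := TendstoInDistribution.delta_method hmeas hlln hclt measurable_shapeScaleOfMoments
    (hasFDerivAt_shapeScaleOfMoments ha hb)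
  simp only [shapeScaleOfMoments_inv_smul_sum, shapeScaleOfMoments_momentVector ha hb,
    id_eq] at hdelta
  -- As a congruence `J S Jᵀ`, the limit matrix inherits semidefiniteness from `S` and is the
  -- covariance of the image of `N(0, S)` under `J`.
  rw [← shapeScaleJacobian_mul_momentCovariance ha hb]
  refine ⟨by simpa using hS.mul_mul_conjTranspose_same (shapeScaleJacobian a b),
    hdelta.forall_aemeasurable, aemeasurable_id, ?_⟩
  convert hdelta.tendsto using 2
  refine congrArg 𝓝 (Subtype.ext ?_)
  simp only
  rw [Measure.map_id, map_toEuclideanCLM_multivariateGaussian hS]
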